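/- A bipartite graph with parts $U$ and $V$ is a chain graph if it is the intersection graph of rightward rays $[a_u,\infty)$ ($u\in U$) and points $p_v$ ($v\in V$) on the real line. Let $\mathrm{CHAIN}^d$ be the class of bipartite graphs with parts $U,V$ that are the (edge) intersection of $d$ chain graphs with the same parts, i.e. the bipartite graphs of Ferrers dimension at most $d$. Let $Z_{\mathrm{CHAIN}^d}(n;k)$ be the maximum number of edges of a graph in $\mathrm{CHAIN}^d$ with $n$ vertices in each part that does not contain the complete bipartite graph $K_{k,k}$ as a subgraph. There is an absolute constant $C>0$ such that for all integers $d\ge 3$, $k\ge 1$ and $n\ge 2$, $$Z_{\mathrm{CHAIN}^d}(n;k)\;\le\; C\, n\,k\,\lceil \log_2 n\rceil^{\,d-3}.$$ -/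

import Mathlib

/-- A bipartite graph with parts `U` and `V` is a *chain graph* if it is the intersection graph of
a family of rightward rays `[a u, ∞)`, `u ∈ U`, and a family of points `p v`, `v ∈ V`,
of the real line. -/
def IsChainGraph {U V : Type*} (G : SimpleGraph (U ⊕ V)) : Prop :=
  G ≤ completeBipartiteGraph U V ∧
    ∃ (a : U → ℝ) (p : V → ℝ), ∀ (u : U) (v : V),
      G.Adj (Sum.inl u) (Sum.inr v) ↔ (Set.Ici (a u) ∩ {p v}).Nonempty

/-- The class `CHAIN ^ d` of bipartite graphs with parts `U` and `V` that are the intersection of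
`d` chain graphs with these parts, that is, the graphs of Ferrers dimension at most `d`
(for `d ≥ 1`). -/
def chainPow (d : ℕ) (U V : Type*) : Set (SimpleGraph (U ⊕ V)) :=
  {G | ∃ H : Fin d → SimpleGraph (U ⊕ V), (∀ i, IsChainGraph (H i)) ∧ G = ⨅ i, H i}

open Classical in
/-- The maximum number of edges of a bipartite graph with parts of sizes `m` and `n` that belongs
to the class `𝒞` and does not contain `K_{k,k}` as a (not necessarily induced) subgraph. -/
noncomputable def classZarankiewicz {m n : ℕ} (𝒞 : Set (SimpleGraph (Fin m ⊕ Fin n)))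
    (k : ℕ) : ℕ :=
  Finset.sup {G : SimpleGraph (Fin m ⊕ Fin n) | G ∈ 𝒞 ∧
      G ≤ completeBipartiteGraph (Fin m) (Fin n) ∧
      (completeBipartiteGraph (Fin k) (Fin k)).Free G}
    (fun G => G.edgeFinset.card)

/-!
The adjacency of a graph in `CHAIN ^ d` is a dominance relation: `u` and `v` are adjacent if and only
if `a i u ≤ p i v` for all `i < d`.

For `d = 3` a biclique-free dominance relation has a vertex of degree `O(k)`, hence `O(k)` edges per
vertex (`pairCount_three_le`). Suppose that all degrees on the side `U` are large. Choose greedily, by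
increasing degree, a subfamily `W` whose neighbourhoods overlap little (`exists_degree_net`). In
dimension three there is a graph on `W` with `O(#W)` edges in which the neighbourhood of each `v`
spans at least its size minus one edges (`exists_sparse_support`); it plays the role of a planar
support. Double counting shows that the degrees over `W` sum to at most `2 * #V`
(`sum_degree_le_of_small_intersections`), so `W` is small. Every other `u ∈ U` shares a fixed
proportion of the neighbourhood of some `w ∈ W`, and only `O(k)` of them can do so for the same `w`
without a `K_{k,k}` (`card_le_of_large_intersections`). So `U` is much smaller than `V`
(`two_mul_card_le_of_large_degree`). The roles of `U` and `V` are symmetric under negation of the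
coordinates, so not all degrees on both sides are large.

Each further coordinate costs a factor `⌈log₂ n⌉` by halving `V` along that coordinate
(`pairCount_and_le`). Starting the recursion at `#V ≤ 2`, where the trivial bound `2 * #U` suffices,
keeps the factor at exactly `⌈log₂ n⌉`, and so the constant does not depend on `d`.
-/

/-! ### Sparse supports in three dimensions -/

/-- A finite set `W` of points with three injective coordinates carries a graph with at most
`4 * #W` edges, namely `q — g j q` for `j : Fin 4`, such that every subset `S` of `W` closed under
passing below joins spans at least `#S - 1` edges.

A point that dominates another one is joined to one such point (`g₀`). Any other `q` is joined to
the points `p` with a smaller first coordinate such that only `p` and `q` lie below `p ∨ q`.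
According to the signs of the differences in the other two coordinates, `p` is determined by `q`
(`g₁`, `g₂`) or `q` by `p` (`g₃`). Every `q ∈ S` that is not minimal in the first coordinate has an
edge in `S` to a point with a smaller first coordinate, and these edges are distinct. -/
theorem exists_sparse_support {α L : Type*} [LinearOrder L] (W : Finset α) (a b c : α → L)
    (ha : a.Injective) (hb : b.Injective) (hc : c.Injective) :
    ∃ g : Fin 4 → α → α, ∀ S ⊆ W, (∀ p ∈ S, ∀ q ∈ S, ∀ r ∈ W, a r ≤ max (a p) (a q) →
        b r ≤ max (b p) (b q) → c r ≤ max (c p) (c q) → r ∈ S) →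
      ∀ [DecidableEq α], S.card ≤ 1 + ∑ j, (S.filter fun q => g j q ∈ S ∧ g j q ≠ q).card := by
  classical
  have pick (P : α → α → Prop) : ∃ g : α → α, ∀ q, (∃ p, P q p) → P q (g q) :=
    ⟨fun q => if h : ∃ p, P q p then h.choose else q, fun q h => by
      simpa only [dif_pos h] using h.choose_spec⟩
  -- `E q p`: `p` precedes `q` in the first coordinate and only `p`, `q` lie below `p ∨ q`.
  let E : α → α → Prop := fun q p => p ∈ W ∧ q ∈ W ∧ a p < a q ∧
    ∀ r ∈ W, a r ≤ max (a p) (a q) → b r ≤ max (b p) (b q) → c r ≤ max (c p) (c q) → r = p ∨ r = q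
  obtain ⟨g₀, h₀⟩ := pick fun q p => p ∈ W ∧ p ≠ q ∧ a p ≤ a q ∧ b p ≤ b q ∧ c p ≤ c q
  obtain ⟨g₁, h₁⟩ := pick fun q p => E q p ∧ b q < b p ∧ c p < c q
  obtain ⟨g₂, h₂⟩ := pick fun q p => E q p ∧ b p < b q ∧ c q < c p
  obtain ⟨g₃, h₃⟩ := pick fun p q => E q p ∧ b q < b p ∧ c q < c p
  refine ⟨![g₀, g₁, g₂, g₃], fun S hSW hS _ => ?_⟩
  rcases S.eq_empty_or_nonempty with rfl | hne
  · simp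
  obtain ⟨m, hm, hmin⟩ := S.exists_min_image a hne
  have cover : S ⊆ {m} ∪ ((S.filter fun q => g₀ q ∈ S ∧ g₀ q ≠ q) ∪
      (S.filter fun q => g₁ q ∈ S ∧ g₁ q ≠ q) ∪ (S.filter fun q => g₂ q ∈ S ∧ g₂ q ≠ q) ∪
      (S.filter fun q => g₃ q ∈ S ∧ g₃ q ≠ q).image g₃) := by
    intro q hq
    by_cases hqm : q = m
    · simp [hqm]
    by_cases hdom : ∃ p, p ∈ W ∧ p ≠ q ∧ a p ≤ a q ∧ b p ≤ b q ∧ c p ≤ c q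
    · obtain ⟨hW, hne', h1, h2, h3⟩ := h₀ q hdom
      have : g₀ q ∈ S := hS q hq q hq _ hW (by simpa) (by simpa) (by simpa)
      simp [hq, this, hne']
    have hma : a m < a q := lt_of_le_of_ne (hmin q hq) fun h => hqm (ha h).symm
    -- Among the candidates `p`, minimise the number of elements below the join `p ∨ q`.
    obtain ⟨p, hp, hpmin⟩ := (S.filter fun p => a p < a q).exists_min_image
      (fun p => (W.filter fun r => a r ≤ max (a p) (a q) ∧ b r ≤ max (b p) (b q) ∧
        c r ≤ max (c p) (c q)).card) ⟨m, by simp [hm, hma]⟩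
    rw [Finset.mem_filter] at hp
    obtain ⟨hpS, hpa⟩ := hp
    have hpq : p ≠ q := by rintro rfl; exact lt_irrefl _ hpa
    have hE : E q p := by
      refine ⟨hSW hpS, hSW hq, hpa, fun r hr hra hrb hrc => ?_⟩
      -- A third point `r` below `p ∨ q` would be a candidate with fewer points below `r ∨ q`:
      -- `p` itself is not below `r ∨ q`, as `q` does not dominate `p`.
      by_contra! hcon
      have hra' : a r < a q := lt_of_le_of_ne (by simpa [hpa.le] using hra) (ha.ne hcon.2)
      have hrS := hS p hpS q hq r hr hra hrb hrc
      have := hpmin r (by simp [hrS, hra'])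
      refine absurd this (not_le.2 (Finset.card_lt_card ?_))
      rw [Finset.ssubset_iff_of_subset]
      · refine ⟨p, by simp [hSW hpS], ?_⟩
        rw [Finset.mem_filter]
        rintro ⟨-, -, hb', hc'⟩
        refine hdom ⟨p, hSW hpS, hpq, hpa.le, ?_, ?_⟩
        · by_contra! h
          have h1 : b p ≤ b r := by simpa [not_le.2 h] using hb'
          have h2 : b r ≤ b p := by simpa [max_eq_left h.le] using hrb
          exact hcon.1 (hb (le_antisymm h2 h1))
        · by_contra! h
          have h1 : c p ≤ c r := by simpa [not_le.2 h] using hc'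
          have h2 : c r ≤ c p := by simpa [max_eq_left h.le] using hrc
          exact hcon.1 (hc (le_antisymm h2 h1))
      · intro s hs
        rw [Finset.mem_filter] at hs ⊢
        exact ⟨hs.1, hs.2.1.trans (max_le hra (le_max_right _ _)),
          hs.2.2.1.trans (max_le hrb (le_max_right _ _)),
          hs.2.2.2.trans (max_le hrc (le_max_right _ _))⟩
    rcases lt_or_gt_of_ne (hb.ne hpq) with hbl | hbg
    · rcases lt_or_gt_of_ne (hc.ne hpq) with hcl | hcg
      · exact absurd ⟨p, hSW hpS, hpq, hpa.le, hbl.le, hcl.le⟩ hdom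
      · obtain ⟨⟨x1, x2, x3, x4⟩, x5, x6⟩ := h₂ q ⟨p, hE, hbl, hcg⟩
        have : p = g₂ q := by
          rcases le_total (c p) (c (g₂ q)) with h | h
          · exact (x4 p (hSW hpS) (le_max_of_le_right hpa.le) (le_max_of_le_right hbl.le)
              (le_max_of_le_left h)).resolve_right hpq
          · exact ((hE.2.2.2 (g₂ q) x1 (le_max_of_le_right x3.le) (le_max_of_le_right x5.le)
              (le_max_of_le_left h)).resolve_right fun h' => by rw [h'] at x3; exact lt_irrefl _ x3).symm
        have h2 : g₂ q ∈ S ∧ g₂ q ≠ q := this ▸ ⟨hpS, hpq⟩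
        simp [hq, h2]
    · rcases lt_or_gt_of_ne (hc.ne hpq) with hcl | hcg
      · obtain ⟨⟨x1, x2, x3, x4⟩, x5, x6⟩ := h₁ q ⟨p, hE, hbg, hcl⟩
        have : p = g₁ q := by
          rcases le_total (b p) (b (g₁ q)) with h | h
          · exact (x4 p (hSW hpS) (le_max_of_le_right hpa.le) (le_max_of_le_left h)
              (le_max_of_le_right hcl.le)).resolve_right hpq
          · exact ((hE.2.2.2 (g₁ q) x1 (le_max_of_le_right x3.le) (le_max_of_le_left h)
              (le_max_of_le_right x6.le)).resolve_right fun h' => by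
                rw [h'] at x3; exact lt_irrefl _ x3).symm
        have h2 : g₁ q ∈ S ∧ g₁ q ≠ q := this ▸ ⟨hpS, hpq⟩
        simp [hq, h2]
      · obtain ⟨⟨x1, x2, x3, x4⟩, x5, x6⟩ := h₃ p ⟨q, hE, hbg, hcg⟩
        have : q = g₃ p := by
          rcases le_total (a q) (a (g₃ p)) with h | h
          · exact (x4 q (hSW hq) (le_max_of_le_right h) (le_max_of_le_left hbg.le)
              (le_max_of_le_left hcg.le)).resolve_left hpq.symm
          · exact ((hE.2.2.2 (g₃ p) x2 (le_max_of_le_right h) (le_max_of_le_left x5.le)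
              (le_max_of_le_left x6.le)).resolve_left fun h' => by
                rw [h'] at x3; exact lt_irrefl _ x3).symm
        refine Finset.mem_union_right _ (Finset.mem_union_right _ (Finset.mem_image.2
          ⟨p, Finset.mem_filter.2 ⟨hpS, ?_, ?_⟩, this.symm⟩))
        · rwa [← this]
        · rw [← this]; exact hpq.symm
  refine (Finset.card_le_card cover).trans ((Finset.card_union_le _ _).trans ?_)
  rw [Finset.card_singleton]
  refine Nat.add_le_add_left ?_ 1
  simp only [Fin.sum_univ_four, Matrix.cons_val]
  refine (Finset.card_union_le _ _).trans (Nat.add_le_add ?_ Finset.card_image_le)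
  exact (Finset.card_union_le _ _).trans (Nat.add_le_add_right (Finset.card_union_le _ _) _)

open Classical in
/-- If the neighbourhoods of the points of `W` overlap pairwise in at most an eighth of their sizes,
then these sizes sum to at most `2 * #V`. Each `v` has a neighbourhood in `W` closed under passing
below joins, so it is counted at most `1 + #{edges of the support in that neighbourhood}` times, and
the overlaps along the edges `u — g j u` of a fixed `j` have total size at most an eighth of the
sum. -/
theorem sum_degree_le_of_small_intersections {α β L : Type*} [LinearOrder L] (W : Finset α)
    (V : Finset β) (R : α → β → Prop) (a b c : α → L)
    (ha : a.Injective) (hb : b.Injective) (hc : c.Injective)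
    (hR : ∀ p q r v, R p v → R q v → a r ≤ max (a p) (a q) → b r ≤ max (b p) (b q) →
      c r ≤ max (c p) (c q) → R r v)
    (hW : ∀ u ∈ W, ∀ w ∈ W, u ≠ w →
      8 * (V.filter fun v => R u v ∧ R w v).card ≤ (V.filter (R u)).card) :
    ∑ u ∈ W, (V.filter (R u)).card ≤ 2 * V.card := by
  obtain ⟨g, hg⟩ := exists_sparse_support W a b c ha hb hc
  have hdeg : ∑ u ∈ W, (V.filter (R u)).card = ∑ v ∈ V, (W.filter fun u => R u v).card :=
    Finset.sum_card_bipartiteAbove_eq_sum_card_bipartiteBelow R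
  have hv : ∀ v ∈ V, (W.filter fun u => R u v).card ≤
      1 + ∑ j, (W.filter fun u => R u v ∧ g j u ∈ W ∧ R (g j u) v ∧ g j u ≠ u).card := by
    intro v _
    refine (hg (W.filter fun u => R u v) (Finset.filter_subset _ _) ?_).trans_eq ?_
    · intro p hp q hq r hr h1 h2 h3
      rw [Finset.mem_filter] at *
      exact ⟨hr, hR p q r v hp.2 hq.2 h1 h2 h3⟩
    · congr 1
      refine Finset.sum_congr rfl fun j _ => ?_
      congr 1
      ext u
      simp only [Finset.mem_filter]
      tauto
  have hj : ∀ j, 8 * ∑ v ∈ V, (W.filter fun u => R u v ∧ g j u ∈ W ∧ R (g j u) v ∧ g j u ≠ u).card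
      ≤ ∑ u ∈ W, (V.filter (R u)).card := by
    intro j
    have hswap : ∑ u ∈ W, (V.filter fun v => R u v ∧ g j u ∈ W ∧ R (g j u) v ∧ g j u ≠ u).card =
        ∑ v ∈ V, (W.filter fun u => R u v ∧ g j u ∈ W ∧ R (g j u) v ∧ g j u ≠ u).card :=
      Finset.sum_card_bipartiteAbove_eq_sum_card_bipartiteBelow _
    rw [← hswap, Finset.mul_sum]
    refine Finset.sum_le_sum fun u hu => ?_
    by_cases h : g j u ∈ W ∧ g j u ≠ u
    · refine le_trans ?_ (hW u hu (g j u) h.1 h.2.symm)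
      refine Nat.mul_le_mul_left _ (Finset.card_le_card fun v => ?_)
      simp only [Finset.mem_filter]
      tauto
    · rw [Finset.filter_false_of_mem (fun v _ => by tauto)]
      simp
  have := Finset.sum_le_sum hv
  rw [← hdeg, Finset.sum_add_distrib, Finset.sum_comm] at this
  simp only [Finset.sum_const, smul_eq_mul, mul_one, Fin.sum_univ_four] at this
  have h0 := hj 0
  have h1 := hj 1
  have h2 := hj 2
  have h3 := hj 3
  omega

/-! ### Biclique-free relations -/

/-- The relation `R` contains no complete bipartite `k × k` subrelation between the finite sets
`U` and `V`. -/
def BicliqueFree {α β : Type*} (R : α → β → Prop) (k : ℕ) (U : Finset α) (V : Finset β) : Prop :=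
  ∀ S ⊆ U, ∀ T ⊆ V, S.card = k → T.card = k → ∃ u ∈ S, ∃ v ∈ T, ¬ R u v

theorem BicliqueFree.mono {α β : Type*} {R : α → β → Prop} {k : ℕ} {U U' : Finset α}
    {V V' : Finset β} (h : BicliqueFree R k U V) (hU : U' ⊆ U) (hV : V' ⊆ V) :
    BicliqueFree R k U' V' :=
  fun S hS T hT => h S (hS.trans hU) T (hT.trans hV)

theorem BicliqueFree.pos {α β : Type*} {R : α → β → Prop} {k : ℕ} {U : Finset α}
    {V : Finset β} (h : BicliqueFree R k U V) : 0 < k := by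
  rcases Nat.eq_zero_or_pos k with rfl | hk
  · simpa using h ∅ (by simp) ∅ (by simp) rfl rfl
  · exact hk

theorem BicliqueFree.swap {α β : Type*} {R : α → β → Prop} {k : ℕ} {U : Finset α}
    {V : Finset β} (h : BicliqueFree R k U V) : BicliqueFree (fun v u => R u v) k V U := by
  intro S hS T hT hSk hTk
  obtain ⟨u, hu, v, hv, huv⟩ := h T hT S hS hTk hSk
  exact ⟨v, hv, u, hu, huv⟩

/-! ### Linear bound in three dimensions -/

/-- A greedy choice by increasing `d`: `d u` stands for the degree of `u` and `I u w` for the size of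
the common neighbourhood of `u` and `w`. -/
theorem exists_degree_net {α : Type*} (U : Finset α) (d : α → ℕ) (I : α → α → ℕ)
    (hI : ∀ u w, I u w = I w u) (hd : ∀ u ∈ U, d u < 8 * I u u) :
    ∃ W ⊆ U, (∀ u ∈ W, ∀ w ∈ W, u ≠ w → 8 * I u w ≤ d u) ∧
      ∀ u ∈ U, ∃ w ∈ W, d w < 8 * I u w := by
  classical
  induction U using Finset.induction_on_max_value d with
  | empty => exact ⟨∅, by simp⟩
  | insert x s hx hmax ih =>
    obtain ⟨W, hWs, hW, hcov⟩ := ih fun u hu => hd u (Finset.mem_insert_of_mem hu)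
    by_cases h : ∃ w ∈ W, d w < 8 * I x w
    · exact ⟨W, hWs.trans (Finset.subset_insert _ _), hW, by
        simpa only [Finset.forall_mem_insert] using ⟨h, hcov⟩⟩
    · push Not at h
      refine ⟨insert x W, Finset.insert_subset_insert _ hWs, ?_, ?_⟩
      · simp only [Finset.forall_mem_insert]
        refine ⟨⟨fun h => absurd rfl h, fun w hw _ => (h w hw).trans (hmax w (hWs hw))⟩,
          fun u hu => ⟨fun _ => hI x u ▸ h u hu, hW u hu⟩⟩
      · simp only [Finset.forall_mem_insert]
        refine ⟨⟨x, by simp, hd x (by simp)⟩, fun u hu => ?_⟩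
        obtain ⟨w, hw, h'⟩ := hcov u hu
        exact ⟨w, Finset.mem_insert_of_mem hw, h'⟩

open Classical in
/-- If each `u ∈ F` is related to more than an eighth of `S`, then few buckets suffice to sort
`F`: by the number of points of `S` that `u` misses in each coordinate, up to `#S / 48`. The missed
sets in a coordinate form a chain, so the members of a bucket, each having more than `6 * #S / 48`
neighbours in `S`, have at least `3 * #S / 48 ≥ k` of them in common. So a bucket has fewer
than `k` members, and there are `49 ^ 3 = 117649` buckets. -/
theorem card_le_of_large_intersections {α β : Type*} {R : α → β → Prop} {k : ℕ} {F : Finset α}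
    {S : Finset β} (a : Fin 3 → α → ℝ) (p : Fin 3 → β → ℝ) (hR : ∀ u v, R u v ↔ ∀ i, a i u ≤ p i v)
    (hfree : BicliqueFree R k F S) (hS : 16 * k ≤ S.card)
    (hF : ∀ u ∈ F, S.card < 8 * (S.filter (R u)).card) :
    F.card ≤ 117649 * k := by
  have hk := hfree.pos
  have hD : 0 < S.card := by omega
  let miss : Fin 3 → α → Finset β := fun i u => S.filter fun v => p i v < a i u
  let key : α → Fin 3 → Fin 49 := fun u i =>
    ⟨48 * (miss i u).card / S.card, by
      have : (miss i u).card ≤ S.card := Finset.card_filter_le _ _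
      rw [Nat.div_lt_iff_lt_mul hD]; omega⟩
  by_contra! hcon
  obtain ⟨κ, -, hκ⟩ := Finset.exists_lt_card_fiber_of_mul_lt_card_of_maps_to
    (f := key) (s := F) (t := Finset.univ) (n := k) (fun _ _ => Finset.mem_univ _) (by
      simpa using hcon)
  set G := F.filter fun u => key u = κ with hG
  have hGne : G.Nonempty := Finset.card_pos.1 (by omega)
  obtain ⟨u₀, hu₀⟩ := hGne
  -- `m i` misses the most points in coordinate `i` among the members of the bucket.
  choose m hm hmax using fun i => G.exists_max_image (a i) ⟨u₀, hu₀⟩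
  set T := S.filter fun v => ∀ u ∈ G, R u v
  have hdiff : ∀ i, 48 * (miss i (m i) \ miss i u₀).card ≤ S.card := by
    intro i
    have hsub : miss i u₀ ⊆ miss i (m i) := fun v hv => by
      rw [Finset.mem_filter] at hv ⊢
      exact ⟨hv.1, hv.2.trans_le (hmax i u₀ hu₀)⟩
    rw [Finset.card_sdiff_of_subset hsub]
    have hkey : key (m i) i = key u₀ i := by
      rw [(Finset.mem_filter.1 (hm i)).2, (Finset.mem_filter.1 hu₀).2]
    have hkey' : 48 * (miss i (m i)).card / S.card = 48 * (miss i u₀).card / S.card :=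
      congrArg Fin.val hkey
    have h1 := Nat.div_add_mod (48 * (miss i (m i)).card) S.card
    have h2 := Nat.div_add_mod (48 * (miss i u₀).card) S.card
    have h3 := Nat.mod_lt (48 * (miss i (m i)).card) hD
    rw [hkey'] at h1
    omega
  have hsub : S.filter (R u₀) ⊆ T ∪ Finset.univ.biUnion fun i => miss i (m i) \ miss i u₀ := by
    intro v hv
    rw [Finset.mem_filter] at hv
    by_cases hvT : v ∈ T
    · exact Finset.mem_union_left _ hvT
    refine Finset.mem_union_right _ ?_
    have : ∃ u ∈ G, ¬ R u v := by
      by_contra! h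
      exact hvT (Finset.mem_filter.2 ⟨hv.1, h⟩)
    obtain ⟨u, hu, huv⟩ := this
    rw [hR] at huv
    push Not at huv
    obtain ⟨i, hi⟩ := huv
    refine Finset.mem_biUnion.2 ⟨i, Finset.mem_univ _, Finset.mem_sdiff.2 ⟨?_, ?_⟩⟩
    · exact Finset.mem_filter.2 ⟨hv.1, hi.trans_le (hmax i u hu)⟩
    · simp [miss, hv.1, (hR _ _).1 hv.2 i]
  have hcard := (Finset.card_le_card hsub).trans ((Finset.card_union_le _ _).trans
    (Nat.add_le_add_left Finset.card_biUnion_le _))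
  rw [Fin.sum_univ_three] at hcard
  have h0 := hdiff 0
  have h1 := hdiff 1
  have h2 := hdiff 2
  have h3 := hF u₀ (Finset.mem_filter.1 hu₀).1
  have hkT : k ≤ T.card := by omega
  obtain ⟨A, hA, hAk⟩ := Finset.exists_subset_card_eq hκ.le
  obtain ⟨B, hB, hBk⟩ := Finset.exists_subset_card_eq hkT
  obtain ⟨u, hu, v, hv, huv⟩ := hfree A (hA.trans (Finset.filter_subset _ _)) B
    (hB.trans (Finset.filter_subset _ _)) hAk hBk
  exact huv ((Finset.mem_filter.1 (hB hv)).2 u (hA hu))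

open Classical in
/-- Here `470596 = 4 * 49 ^ 3`: a net `W` of `U` has total degree at most `2 * #V`, and each of its
members accounts for at most `49 ^ 3 * k` elements of `U`. -/
theorem two_mul_card_le_of_large_degree {α β : Type*} [LinearOrder α] {R : α → β → Prop} {k : ℕ}
    {U : Finset α} {V : Finset β} (a : Fin 3 → α → ℝ) (p : Fin 3 → β → ℝ)
    (hR : ∀ u v, R u v ↔ ∀ i, a i u ≤ p i v) (hfree : BicliqueFree R k U V)
    (hdeg : ∀ u ∈ U, 470596 * k ≤ (V.filter (R u)).card) :
    2 * U.card ≤ V.card := by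
  have hk := hfree.pos
  obtain ⟨W, hWU, hW, hcov⟩ := exists_degree_net U (fun u => (V.filter (R u)).card)
    (fun u w => (V.filter fun v => R u v ∧ R w v).card)
    (fun u w => by simp only [and_comm]) (fun u hu => by
      have := hdeg u hu
      have hself : (V.filter fun v => R u v ∧ R u v) = V.filter (R u) := by ext; simp
      rw [hself]
      omega)
  -- Breaking ties by the order on `α` makes the three coordinates injective.
  let a' : Fin 3 → α → ℝ ×ₗ α := fun i u => toLex (a i u, u)
  have ha' : ∀ i, (a' i).Injective := fun i u w h => (Prod.mk.inj (toLex.injective h)).2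
  have hmono : ∀ i p q r, a' i r ≤ max (a' i p) (a' i q) → a i r ≤ max (a i p) (a i q) := by
    intro i p q r h
    rw [le_max_iff] at h ⊢
    refine h.imp (fun h => ?_) (fun h => ?_) <;>
    · rw [Prod.Lex.toLex_le_toLex] at h
      exact h.elim le_of_lt fun h => h.1.le
  have hsum := sum_degree_le_of_small_intersections W V R (a' 0) (a' 1) (a' 2) (ha' 0) (ha' 1)
    (ha' 2) (fun x y r v hx hy h0 h1 h2 => by
      rw [hR] at *
      have key : ∀ i, a i r ≤ max (a i x) (a i y) := by
        intro i
        fin_cases i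
        exacts [hmono _ _ _ _ h0, hmono _ _ _ _ h1, hmono _ _ _ _ h2]
      exact fun i => (key i).trans (max_le (hx i) (hy i))) hW
  have hlow : W.card * (470596 * k) ≤ ∑ u ∈ W, (V.filter (R u)).card := by
    rw [← smul_eq_mul]
    exact Finset.card_nsmul_le_sum _ _ _ fun u hu => hdeg u (hWU hu)
  have hU : U ⊆ W.biUnion fun w => U.filter fun u =>
      (V.filter (R w)).card < 8 * (V.filter fun v => R u v ∧ R w v).card := by
    intro u hu
    obtain ⟨w, hw, h⟩ := hcov u hu
    exact Finset.mem_biUnion.2 ⟨w, hw, Finset.mem_filter.2 ⟨hu, h⟩⟩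
  have hUcard : U.card ≤ W.card * (117649 * k) := by
    refine (Finset.card_le_card hU).trans (Finset.card_biUnion_le_card_mul _ _ _ fun w hw => ?_)
    refine card_le_of_large_intersections (S := V.filter (R w)) a p hR
      (hfree.mono (Finset.filter_subset _ _) (Finset.filter_subset _ _)) ?_ ?_
    · have := hdeg w (hWU hw)
      omega
    · intro u hu
      rw [Finset.filter_filter]
      simpa only [and_comm] using (Finset.mem_filter.1 hu).2
  have : W.card * (470596 * k) = 4 * (W.card * (117649 * k)) := by ring
  omega

open Classical in
/-- The number of pairs of the relation `R` between the finite sets `U` and `V`. -/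
noncomputable def pairCount {α β : Type*} (R : α → β → Prop) (U : Finset α) (V : Finset β) : ℕ :=
  ∑ u ∈ U, (V.filter (R u)).card

open Classical in
theorem pairCount_swap {α β : Type*} (R : α → β → Prop) (U : Finset α) (V : Finset β) :
    pairCount R U V = pairCount (fun v u => R u v) V U :=
  Finset.sum_card_bipartiteAbove_eq_sum_card_bipartiteBelow R

theorem pairCount_union_left {α β : Type*} [DecidableEq α] (R : α → β → Prop) {U U' : Finset α}
    (h : Disjoint U U') (V : Finset β) :
    pairCount R (U ∪ U') V = pairCount R U V + pairCount R U' V :=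
  Finset.sum_union h

theorem pairCount_union_right {α β : Type*} [DecidableEq β] (R : α → β → Prop) (U : Finset α)
    {V V' : Finset β} (h : Disjoint V V') :
    pairCount R U (V ∪ V') = pairCount R U V + pairCount R U V' := by
  simp only [pairCount_swap R U, pairCount_union_left _ h]

theorem pairCount_le_mul {α β : Type*} (R : α → β → Prop) (U : Finset α) (V : Finset β) :
    pairCount R U V ≤ U.card * V.card := by
  classical
  exact (Finset.sum_le_card_nsmul _ _ _ fun u _ => Finset.card_filter_le _ _).trans_eq
    (smul_eq_mul _ _)

theorem pairCount_eq_zero {α β : Type*} {R : α → β → Prop} {U : Finset α} {V : Finset β}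
    (h : ∀ u ∈ U, ∀ v ∈ V, ¬ R u v) : pairCount R U V = 0 :=
  Finset.sum_eq_zero fun u hu => by simpa [Finset.filter_eq_empty_iff] using h u hu

theorem pairCount_congr {α β : Type*} {R R' : α → β → Prop} {U : Finset α} {V : Finset β}
    (h : ∀ u ∈ U, ∀ v ∈ V, (R u v ↔ R' u v)) : pairCount R U V = pairCount R' U V := by
  classical
  exact Finset.sum_congr rfl fun u hu => congrArg _ (Finset.filter_congr fun v hv => h u hu v hv)

/-- Otherwise delete a vertex of degree less than `470596 * k`. There always is one: if there were
none, then `2 * #U ≤ #V` and, by the symmetry of the situation, `2 * #V ≤ #U`. -/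
theorem pairCount_three_le {α β : Type*} [LinearOrder α] [LinearOrder β] {R : α → β → Prop} {k : ℕ}
    (a : Fin 3 → α → ℝ) (p : Fin 3 → β → ℝ) (hR : ∀ u v, R u v ↔ ∀ i, a i u ≤ p i v)
    (U : Finset α) (V : Finset β) (hfree : BicliqueFree R k U V) :
    pairCount R U V ≤ 470596 * k * (U.card + V.card) := by
  classical
  induction hs : U.card + V.card generalizing U V with
  | zero =>
    have hU : U = ∅ := Finset.card_eq_zero.1 (by omega)
    simp [hU, pairCount]
  | succ s ih =>
    by_cases h1 : ∃ u ∈ U, (V.filter (R u)).card < 470596 * k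
    · obtain ⟨u, hu, hlt⟩ := h1
      have hc := Finset.card_erase_add_one hu
      have := ih (U.erase u) V (hfree.mono (Finset.erase_subset _ _) subset_rfl) (by omega)
      have hsum : pairCount R U V = (V.filter (R u)).card + pairCount R (U.erase u) V :=
        (Finset.add_sum_erase U (fun u => (V.filter (R u)).card) hu).symm
      rw [mul_add_one]
      omega
    by_cases h2 : ∃ v ∈ V, (U.filter fun u => R u v).card < 470596 * k
    · obtain ⟨v, hv, hlt⟩ := h2
      have hc := Finset.card_erase_add_one hv
      have := ih U (V.erase v) (hfree.mono subset_rfl (Finset.erase_subset _ _)) (by omega)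
      rw [pairCount_swap] at this ⊢
      have hsum : pairCount (fun v u => R u v) V U = (U.filter fun u => R u v).card +
          pairCount (fun v u => R u v) (V.erase v) U :=
        (Finset.add_sum_erase V (fun v => (U.filter fun u => R u v).card) hv).symm
      rw [mul_add_one]
      omega
    push Not at h1 h2
    have e1 := two_mul_card_le_of_large_degree a p hR hfree h1
    have e2 := two_mul_card_le_of_large_degree (R := fun v u => R u v) (fun i v => -p i v)
      (fun i u => -a i u) (fun v u => by simp [hR]) hfree.swap h2
    omega

/-! ### Adding a coordinate -/

theorem exists_initial_subset {β : Type*} (V : Finset β) (f : β → ℝ) {m : ℕ} (hm : m ≤ V.card) :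
    ∃ V₁ ⊆ V, V₁.card = m ∧ ∀ x ∈ V₁, ∀ y ∈ V, y ∉ V₁ → f x ≤ f y := by
  classical
  induction m with
  | zero => exact ⟨∅, by simp⟩
  | succ m ih =>
    obtain ⟨V₁, hV, hc, h⟩ := ih (by omega)
    obtain ⟨z, hz, hmin⟩ := (V \ V₁).exists_min_image f (Finset.card_pos.1 (by
      rw [Finset.card_sdiff_of_subset hV]; omega))
    rw [Finset.mem_sdiff] at hz
    refine ⟨insert z V₁, Finset.insert_subset hz.1 hV, by
      rw [Finset.card_insert_of_notMem hz.2, hc], fun x hx y hy hyn => ?_⟩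
    rw [Finset.mem_insert, not_or] at hyn
    rcases Finset.mem_insert.1 hx with rfl | hx
    · exact hmin y (Finset.mem_sdiff.2 ⟨hy, hyn.2⟩)
    · exact h x hx y hy hyn.2

/-- Adding one coordinate costs a factor `j` when `V` has at most `2 ^ j` elements: halve `V` by the
value of `p`. The elements `u` with `a u` below the upper half `V₂` meet no new condition there, and
the other ones are related to nothing in the lower half `V₁`. -/
theorem pairCount_and_le {α β : Type*} {R : α → β → Prop} {k A L : ℕ} (a : α → ℝ) (p : β → ℝ)
    (hA : 2 ≤ A)
    (hR : ∀ (U : Finset α) (V : Finset β), V.card ≤ 2 ^ L → BicliqueFree R k U V →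
      pairCount R U V ≤ A * (U.card + V.card)) {j : ℕ} (hj : 1 ≤ j) (hjL : j ≤ L)
    (U : Finset α) (V : Finset β) (hV : V.card ≤ 2 ^ j)
    (hfree : BicliqueFree (fun u v => R u v ∧ a u ≤ p v) k U V) :
    pairCount (fun u v => R u v ∧ a u ≤ p v) U V ≤ A * j * (U.card + V.card) := by
  classical
  induction j, hj using Nat.le_induction generalizing U V with
  | base =>
    refine (pairCount_le_mul _ _ _).trans ?_
    have h2 : V.card ≤ A := by omega
    nlinarith [Nat.mul_le_mul_left U.card h2]
  | succ j hj ih =>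
    obtain ⟨V₁, hV₁, hc, hle⟩ := exists_initial_subset V p
      (m := min V.card (2 ^ j)) (min_le_left _ _)
    set V₂ := V \ V₁ with hV₂
    have hV12 : V = V₁ ∪ V₂ := (Finset.union_sdiff_of_subset hV₁).symm
    have hdV : Disjoint V₁ V₂ := Finset.disjoint_sdiff
    have hcV : V.card = V₁.card + V₂.card := by rw [← Finset.card_union_of_disjoint hdV, ← hV12]
    have hpow : 2 ^ (j + 1) = 2 ^ j + 2 ^ j := by ring
    have hc1 : V₁.card ≤ 2 ^ j := by omega
    have hc2 : V₂.card ≤ 2 ^ j := by omega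
    set U₁ := U.filter fun u => ∀ v ∈ V₂, a u ≤ p v with hU₁
    set U₂ := U.filter fun u => ¬ ∀ v ∈ V₂, a u ≤ p v with hU₂
    have hU12 : U = U₁ ∪ U₂ := (Finset.filter_union_filter_not_eq _ _).symm
    have hdU : Disjoint U₁ U₂ := Finset.disjoint_filter_filter_not _ _ _
    have hcU : U.card = U₁.card + U₂.card := by rw [← Finset.card_union_of_disjoint hdU, ← hU12]
    have hUs1 : U₁ ⊆ U := Finset.filter_subset _ _
    have hUs2 : U₂ ⊆ U := Finset.filter_subset _ _
    have hVs2 : V₂ ⊆ V := Finset.sdiff_subset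
    have h11 := ih (by omega) U₁ V₁ hc1 (hfree.mono hUs1 hV₁)
    have h22 := ih (by omega) U₂ V₂ hc2 (hfree.mono hUs2 hVs2)
    have hfull : ∀ u ∈ U₁, ∀ v ∈ V₂, (R u v ∧ a u ≤ p v ↔ R u v) := fun u hu v hv =>
      and_iff_left ((Finset.mem_filter.1 hu).2 v hv)
    have h12 : pairCount (fun u v => R u v ∧ a u ≤ p v) U₁ V₂ ≤ A * (U₁.card + V₂.card) := by
      rw [pairCount_congr hfull]
      refine hR U₁ V₂ (hc2.trans (Nat.pow_le_pow_right (by norm_num) (by omega))) ?_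
      intro S hS T hT hSk hTk
      obtain ⟨u, hu, v, hv, huv⟩ := hfree S (hS.trans hUs1) T (hT.trans hVs2) hSk hTk
      exact ⟨u, hu, v, hv, fun h => huv ((hfull u (hS hu) v (hT hv)).2 h)⟩
    have h21 : pairCount (fun u v => R u v ∧ a u ≤ p v) U₂ V₁ = 0 := by
      refine pairCount_eq_zero fun u hu v hv ⟨_, huv⟩ => ?_
      refine (Finset.mem_filter.1 hu).2 fun w hw => huv.trans ?_
      rw [hV₂, Finset.mem_sdiff] at hw
      exact hle v hv w hw.1 hw.2
    have hsplit : pairCount (fun u v => R u v ∧ a u ≤ p v) U V =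
        pairCount (fun u v => R u v ∧ a u ≤ p v) U₁ V₁ +
          pairCount (fun u v => R u v ∧ a u ≤ p v) U₁ V₂ +
        (pairCount (fun u v => R u v ∧ a u ≤ p v) U₂ V₁ +
          pairCount (fun u v => R u v ∧ a u ≤ p v) U₂ V₂) := by
      conv_lhs => rw [hU12, hV12]
      rw [pairCount_union_left _ hdU, pairCount_union_right _ _ hdV, pairCount_union_right _ _ hdV]
    rw [hsplit, hcU, hcV, h21]
    calc _ ≤ A * j * (U₁.card + V₁.card) + A * (U₁.card + V₂.card) +
          (0 + A * j * (U₂.card + V₂.card)) := by gcongr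
      _ ≤ A * (j + 1) * (U₁.card + U₂.card + (V₁.card + V₂.card)) := by
        have : A * (j + 1) * (U₁.card + U₂.card + (V₁.card + V₂.card)) =
            A * j * (U₁.card + V₁.card) + A * (U₁.card + V₂.card) +
              (0 + A * j * (U₂.card + V₂.card)) + A * (U₂.card + V₁.card) := by ring
        omega

theorem pairCount_le {α β : Type*} [LinearOrder α] [LinearOrder β] (a : ℕ → α → ℝ)
    (p : ℕ → β → ℝ) {d k L : ℕ} (hd : 3 ≤ d) (hL : 1 ≤ L) (U : Finset α) (V : Finset β)
    (hV : V.card ≤ 2 ^ L) (hfree : BicliqueFree (fun u v => ∀ i < d, a i u ≤ p i v) k U V) :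
    pairCount (fun u v => ∀ i < d, a i u ≤ p i v) U V ≤
      470596 * k * L ^ (d - 3) * (U.card + V.card) := by
  have hk := hfree.pos
  induction d, hd using Nat.le_induction generalizing U V with
  | base =>
    simpa using pairCount_three_le (fun i => a i) (fun i => p i)
      (fun u v => ⟨fun h i => h i i.2, fun h i hi => h ⟨i, hi⟩⟩) U V hfree
  | succ d hd ih =>
    have hsplit : (fun u v => ∀ i < d + 1, a i u ≤ p i v) =
        fun u v => (∀ i < d, a i u ≤ p i v) ∧ a d u ≤ p d v := by
      ext u v
      exact Nat.forall_lt_succ_right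
    rw [hsplit] at hfree ⊢
    have hpos : 1 ≤ k * L ^ (d - 3) := Nat.mul_pos hk (Nat.pow_pos hL)
    have := pairCount_and_le (a d) (p d) (A := 470596 * k * L ^ (d - 3)) (by
      rw [mul_assoc]; omega) ih hL le_rfl U V hV hfree
    rwa [show d + 1 - 3 = d - 3 + 1 by omega, pow_succ, ← mul_assoc]

/-! ### Graphs in `CHAIN ^ d` -/

theorem exists_coordinates_of_mem_chainPow {U V : Type*} {d : ℕ} {G : SimpleGraph (U ⊕ V)}
    (hG : G ∈ chainPow d U V) : ∃ (a : ℕ → U → ℝ) (p : ℕ → V → ℝ), ∀ u v,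
      G.Adj (Sum.inl u) (Sum.inr v) ↔ ∀ i < d, a i u ≤ p i v := by
  obtain ⟨H, hH, rfl⟩ := hG
  choose a p hap using fun i => (hH i).2
  refine ⟨fun i => if h : i < d then a ⟨i, h⟩ else 0, fun i => if h : i < d then p ⟨i, h⟩ else 0,
    fun u v => ?_⟩
  simp only [SimpleGraph.iInf_adj, hap, Set.inter_singleton_nonempty, Set.mem_Ici]
  refine ⟨fun h i hi => by simpa [hi] using h.1 ⟨i, hi⟩, fun h => ⟨fun i => ?_, Sum.inl_ne_inr⟩⟩
  simpa using h i i.2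

theorem bicliqueFree_of_free {U V : Type*} {k : ℕ} {G : SimpleGraph (U ⊕ V)}
    (hG : (completeBipartiteGraph (Fin k) (Fin k)).Free G) (S : Finset U) (T : Finset V) :
    BicliqueFree (fun u v => G.Adj (Sum.inl u) (Sum.inr v)) k S T := by
  intro A _ B _ hA hB
  by_contra! h
  let e := A.equivFinOfCardEq hA
  let f := B.equivFinOfCardEq hB
  refine hG ⟨⟨⟨Sum.map (fun i => (e.symm i : U)) (fun i => (f.symm i : V)), ?_⟩, ?_⟩⟩
  · rintro (x | x) (y | y) hxy
    · simp at hxy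
    · exact h _ (e.symm x).2 _ (f.symm y).2
    · exact (h _ (e.symm y).2 _ (f.symm x).2).symm
    · simp at hxy
  · exact Sum.map_injective.2 ⟨Subtype.val_injective.comp e.symm.injective,
      Subtype.val_injective.comp f.symm.injective⟩

theorem card_edgeFinset_le_pairCount {U V : Type*} [Fintype U] [Fintype V]
    {G : SimpleGraph (U ⊕ V)} [Fintype G.edgeSet] (hG : G ≤ completeBipartiteGraph U V) :
    G.edgeFinset.card ≤ pairCount (fun u v => G.Adj (Sum.inl u) (Sum.inr v))
      Finset.univ Finset.univ := by
  classical
  have hsub : G.edgeFinset ⊆ (Finset.univ.sigma fun u =>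
      Finset.univ.filter fun v => G.Adj (Sum.inl u) (Sum.inr v)).image
        fun x : (_ : U) × V => s(Sum.inl x.1, Sum.inr x.2) := by
    intro e he
    rw [SimpleGraph.mem_edgeFinset] at he
    induction e using Sym2.ind with
    | _ x y =>
      rw [SimpleGraph.mem_edgeSet] at he
      have := hG he
      rcases x with x | x <;> rcases y with y | y
      · simp at this
      · exact Finset.mem_image.2 ⟨⟨x, y⟩, by simpa using he, rfl⟩
      · exact Finset.mem_image.2 ⟨⟨y, x⟩, by simpa using he.symm, Sym2.eq_swap⟩
      · simp at this
  refine (Finset.card_le_card hsub).trans (Finset.card_image_le.trans ?_)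
  rw [Finset.card_sigma, pairCount]

theorem corollary2 :
    ∃ C : ℝ, 0 < C ∧ ∀ d k n : ℕ, 3 ≤ d → 2 ≤ n →
      (classZarankiewicz (chainPow d (Fin n) (Fin n)) k : ℝ) ≤
        C * (n * k * (⌈Real.logb 2 (n : ℝ)⌉₊ : ℝ) ^ (d - 3)) := by
  refine ⟨941192, by norm_num, fun d k n hd hn => ?_⟩
  have hn' : (2 : ℝ) ≤ n := by exact_mod_cast hn
  set L := ⌈Real.logb 2 (n : ℝ)⌉₊ with hL
  have hL1 : 1 ≤ L := Nat.ceil_pos.2 (Real.logb_pos (by norm_num) (by linarith))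
  have hnL : n ≤ 2 ^ L := by
    have h := (Real.logb_le_iff_le_rpow (by norm_num) (by linarith)).1
      (Nat.le_ceil (Real.logb 2 (n : ℝ)))
    rw [← hL, Real.rpow_natCast] at h
    exact_mod_cast h
  have key : classZarankiewicz (chainPow d (Fin n) (Fin n)) k ≤
      941192 * (n * k * L ^ (d - 3)) := by
    classical
    refine Finset.sup_le fun G hG => ?_
    obtain ⟨hG, hbip, hfree⟩ := (Finset.mem_filter.1 hG).2
    obtain ⟨a, p, hap⟩ := exists_coordinates_of_mem_chainPow hG
    have hb := bicliqueFree_of_free hfree Finset.univ Finset.univ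
    refine (card_edgeFinset_le_pairCount hbip).trans ?_
    simp only [hap] at hb ⊢
    refine (pairCount_le a p hd hL1 _ _ (by simpa using hnL) hb).trans_eq ?_
    rw [Finset.card_univ, Fintype.card_fin]
    ring
  exact_mod_cast key
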